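/- Let $G=(V,E)$ be a finite directed acyclic multigraph (a network with unit-capacity channels $e\in E$, each with nodes $tail(e)$ and $head(e)$) with a single source node $s$ that has no incoming channels. Let $\omega\ge 1$ be an integer (the information rate) and $\mathcal F$ a field. *Cuts.* A *collection* is a set $T$ of non-source nodes. $C_T$ is the minimum number of channels whose removal leaves no node of $T$ reachable from $s$. Write $C_t=C_{\{t\}}$, $\delta_T=C_T-\omega$ and $\delta_t=C_t-\omega$. Let $In(T)$ be the set of channels whose head lies in $T$, and $\mathcal T$ the set of all nonempty collections. *Codes.* Let $In(s)=\{d_1',\dots,d_\omega'\}$ be $\omega$ imaginary message channels, and let $In(i)$ be the set of channels with head $i$ if $i\neq s$. An $\omega$-dimensional $\mathcal F$-valued linear network error correction (LNEC) code consists of coefficients $k_{d,e}\in\mathcal F$ ($e\in E$, $d\in In(tail(e))$) and column vectors $\tilde f_d\in\mathcal F^{In(s)\cup E}$ ($d\in In(s)\cup E$) with $\tilde f_{d_i'}=1_{d_i'}$ and $\tilde f_e=\sum_{d\in In(tail(e))}k_{d,e}\tilde f_d+1_e$ for $e\in E$, where $1_d$ is the indicator vector of $d$. For a collection $T$ and $d\in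 In(s)\cup E$ let $row_T(d)=[\tilde f_e(d)]_{e\in In(T)}$. Put $\Phi(T)=\langle row_T(d_i'):1\le i\le\omega\rangle$, $\Delta(T,\rho)=\langle row_T(e):e\in\rho\rangle$ for $\rho\subseteq E$, and $$d_{\min}^{(T)}=\min\{|\rho|:\rho\subseteq E,\ \Delta(T,\rho)\cap\Phi(T)\ne\{0\}\},$$ and write $\Phi(t)=\Phi(\{t\})$, $d_{\min}^{(t)}=d_{\min}^{(\{t\})}$. The code is 1. a *multicast MDS code* if $\dim\Phi(t)=\omega$ and $d^{(t)}_{\min}=\delta_t+1$ for every non-source node $t$ with $C_t\ge\omega$; 2. a *broadcast MDS code* if, for every non-source node $t$, $\dim\Phi(t)=\min\{\omega,C_t\}$, and $d^{(t)}_{\min}=\delta_t+1$ when $C_t\ge\omega$, $d^{(t)}_{\min}=1$ when $C_t<\omega$; 3. a *dispersion MDS code* if, for every $T\in\mathcal T$, $\dim\Phi(T)=\min\{\omega,C_T\}$, and $d^{(T)}_{\min}=\delta_T+1$ when $C_T\ge\omega$, $d^{(T)}_{\min}=1$ when $C_T<\omega$. **Claim.** Sums over $t$ run over non-source nodes. 1.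 If $|\mathcal F|>\sum_{t:\,C_t\ge\omega}\binom{|E|}{\delta_t}$, then there is an $\omega$-dimensional $\mathcal F$-valued LNEC multicast MDS code on $G$. Assume moreover, for 2 and 3, that every non-source node can be reached from $s$, i.e. $C_t\ge1$ for all $t\neq s$. 2. If $|\mathcal F|>\sum_{t:\,C_t\ge\omega}\binom{|E|}{\delta_t}+|V_2|$, where $V_2$ is the set of non-source nodes $t$ with $C_t<\omega$, then there is an $\omega$-dimensional $\mathcal F$-valued LNEC broadcast MDS code on $G$. 3. If $$|\mathcal F|>\sum_{T\in\mathcal T:\,C_T\ge\omega}\binom{|E|+\sum_{T'\in\mathcal T}\sum_{t\in T'}C_t}{\delta_T}+|V_3|,$$ where $V_3$ is the set of $T\in\mathcal T$ with $C_T<\omega$, then there is an $\omega$-dimensional $\mathcal F$-valued LNEC dispersion MDS code on $G$. -/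

import Mathlib

namespace LNEC

/-- A single source network: a finite directed acyclic multigraph with node set `V` and channel
set `E` (all channels of unit capacity, parallel channels allowed), whose source node has no
incoming channels. -/
structure Network (V E : Type*) where
  /-- the node a channel leaves -/
  tail : E → V
  /-- the node a channel enters -/
  head : E → V
  /-- the unique source node `s` -/
  source : V
  acyclic : ∀ v : V, ¬ Relation.TransGen (fun a b => ∃ e : E, tail e = a ∧ head e = b) v v
  head_ne_source : ∀ e : E, head e ≠ source

namespace Network

variable {V E : Type*} (N : Network V E)

/-- After removal of the channels in `A`, no node of `T` can be reached from the source. -/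
def IsCut (T : Finset V) (A : Finset E) : Prop :=
  ∀ t ∈ T,
    ¬ Relation.ReflTransGen (fun a b => ∃ e : E, e ∉ A ∧ N.tail e = a ∧ N.head e = b) N.source t

/-- The minimum cut capacity `C_T` between the source and the collection `T` of non-source nodes.
For a single node `t` it is used with `T = {t}`. -/
noncomputable def minCut (T : Finset V) : ℕ :=
  sInf {n : ℕ | ∃ A : Finset E, N.IsCut T A ∧ A.card = n}

/-- The set of all non-source nodes. -/
def nonSource [Fintype V] [DecidableEq V] : Finset V :=
  Finset.univ.filter fun t => t ≠ N.source

/-- The set of all nonempty collections of non-source nodes. -/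
def collections [Fintype V] [DecidableEq V] : Finset (Finset V) :=
  N.nonSource.powerset.filter fun T => T.Nonempty

/-- The set `In(i)`, where `Sum.inl j` stands for the `j`-th imaginary message channel and
`Sum.inr d` for the channel `d` of the network: the source has the `ω` imaginary message
channels as incoming channels, any other node its real incoming channels. -/
def incoming (ω : ℕ) [Fintype E] [DecidableEq V] [DecidableEq E] (i : V) :
    Finset (Fin ω ⊕ E) :=
  if i = N.source then Finset.univ.image Sum.inl
  else (Finset.univ.filter fun d : E => N.head d = i).image Sum.inr

end Network

/-- An `ω`-dimensional `F`-valued linear network error correction code on `N`, by its global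
description: local encoding coefficients `k d e` (only the adjacent pairs `d ∈ In(tail e)` matter)
together with the extended global encoding kernels `kernel d`, vectors indexed by `In(s) ∪ E`.
The term `Pi.single (Sum.inr e) 1` is the kernel of the imaginary error channel of `e`. -/
structure Code {V E : Type*} [Fintype E] [DecidableEq V] [DecidableEq E]
    (N : Network V E) (F : Type*) [Field F] (ω : ℕ) where
  k : Fin ω ⊕ E → E → F
  kernel : Fin ω ⊕ E → (Fin ω ⊕ E → F)
  kernel_message : ∀ i : Fin ω, kernel (Sum.inl i) = Pi.single (Sum.inl i) 1
  kernel_channel : ∀ e : E,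
    kernel (Sum.inr e) =
      ∑ d ∈ N.incoming ω (N.tail e), k d e • kernel d + Pi.single (Sum.inr e) 1

namespace Code

variable {V E : Type*} [Fintype V] [Fintype E] [DecidableEq V] [DecidableEq E]
  {N : Network V E} {F : Type*} [Field F] {ω : ℕ} (c : Code N F ω)

/-- The row indexed by `d ∈ In(s) ∪ E` of the decoding matrix of `T`, whose columns are the
extended global encoding kernels of the channels in `In(T)`. -/
def row (T : Finset V) (d : Fin ω ⊕ E) : {e : E // N.head e ∈ T} → F :=
  fun e => c.kernel (Sum.inr e.1) d

/-- The message space `Φ(T)`. -/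
def messageSpace (T : Finset V) : Submodule F ({e : E // N.head e ∈ T} → F) :=
  Submodule.span F (Set.range fun i : Fin ω => c.row T (Sum.inl i))

/-- The error space `Δ(T, ρ)` of the error pattern `ρ`. -/
def errorSpace (T : Finset V) (ρ : Finset E) : Submodule F ({e : E // N.head e ∈ T} → F) :=
  Submodule.span F ((fun e : E => c.row T (Sum.inr e)) '' (ρ : Set E))

/-- The minimum distance at `T`: the least size of an error pattern whose error space meets the
message space nontrivially. (It is only ever equated with positive numbers, which forces such a
pattern to exist, because `sInf ∅ = 0`.) -/
noncomputable def minDist (T : Finset V) : ℕ :=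
  sInf {n : ℕ | ∃ ρ : Finset E, c.errorSpace T ρ ⊓ c.messageSpace T ≠ ⊥ ∧ ρ.card = n}

/-- The right-hand side of the extended Singleton bound at `T`. -/
noncomputable def singletonBound (N : Network V E) (ω : ℕ) (T : Finset V) : ℕ :=
  if ω ≤ N.minCut T then N.minCut T - ω + 1 else 1

def IsRegular : Prop :=
  ∀ t ∈ N.nonSource, ω ≤ N.minCut {t} → Module.finrank F (c.messageSpace {t}) = ω

def IsStronglyRegular : Prop :=
  ∀ t ∈ N.nonSource, Module.finrank F (c.messageSpace {t}) = min ω (N.minCut {t})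

def IsStronglySupRegular : Prop :=
  ∀ T ∈ N.collections, Module.finrank F (c.messageSpace T) = min ω (N.minCut T)

def IsMulticastMDS : Prop :=
  c.IsRegular ∧
    ∀ t ∈ N.nonSource, ω ≤ N.minCut {t} → c.minDist {t} = N.minCut {t} - ω + 1

def IsBroadcastMDS : Prop :=
  c.IsStronglyRegular ∧ ∀ t ∈ N.nonSource, c.minDist {t} = singletonBound N ω {t}

def IsDispersionMDS : Prop :=
  c.IsStronglySupRegular ∧ ∀ T ∈ N.collections, c.minDist T = singletonBound N ω T

end Code

end LNEC

/-! Work in the line graph, whose vertices are the message channels and the channels. With `K` the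
matrix of local coefficients, the entries `f_e(d)` form the transfer matrix `G = (1 - K)⁻¹`. All
requirements on the code follow from finitely many conditions of one type: the rows `R` of `G` are
linearly independent in the columns `L = In(T)`.

Suppose `C_T ≥ ω`. For each error pattern `ρ` of size `δ_T`, take a smallest set `ρ'` separating `ρ`
from `In(T)`. The rows of `ρ` lie in the span of those of `ρ'`, so it suffices that the message rows
and the rows of `ρ'` are jointly independent. This makes `Δ(T,ρ)` meet `Φ(T)` trivially. A dimension
count on a minimum cut gives the opposite bound on the distance. If `C_T < ω`, independence of `C_T`
message rows is enough: `Φ(T)` is then the row space of a minimum cut, and a nonzero row of that cut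
yields distance one. So each large cut contributes `binom(|E|, δ_T)` conditions and each small cut
one.

Each condition is solvable because no set smaller than `R` separates `R` from `L`
(`card_le_of_separates` when `C_T ≥ ω`). Over an infinite field, one generic choice of coefficients
gives every submatrix of `G` rank at least the size of some separator (`exists_generic_kernel`, a
linear form of Menger's theorem), hence satisfies all conditions at once.

The bound on `|F|` comes from Edmonds' form of the conditions (`IsKernel.linearIndependent_iff`):
each local coefficient enters at most one vector of the family, and affinely, so a solved condition
excludes at most one value of each coefficient. Starting from a generic solution over the algebraic
closure, the coefficients can be moved into `F` one at a time, as there are fewer conditions than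
elements of `F`. -/

namespace LNEC

/-! ### Vertex separators in a digraph -/

section Reachability

variable {D : Type*}

/-- The vertices which can be reached from `R` by a directed path avoiding `A`, in the digraph
with in-neighbourhoods `pred`. -/
inductive Reach (pred : D → Finset D) (R A : Finset D) : D → Prop
  | start {d : D} : d ∈ R → d ∉ A → Reach pred R A d
  | step {d e : D} : Reach pred R A d → d ∈ pred e → e ∉ A → Reach pred R A e

/-- Every directed path from `R` to `L` meets `A`. -/
def Separates (pred : D → Finset D) (A R L : Finset D) : Prop :=
  ∀ d ∈ L, ¬ Reach pred R A d

variable {pred : D → Finset D} {A A' R R' L : Finset D}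

theorem Reach.notMem {d : D} (h : Reach pred R A d) : d ∉ A := by
  cases h <;> assumption

theorem Reach.mono (hR : R ⊆ R') (hA : A' ⊆ A) {d : D} (h : Reach pred R A d) :
    Reach pred R' A' d := by
  induction h with
  | start h1 h2 => exact .start (hR h1) fun h => h2 (hA h)
  | step _ h2 h3 ih => exact .step ih h2 fun h => h3 (hA h)

/-- A path must avoid `A` from its first vertex on, so separators may use vertices of `R` itself. -/
theorem separates_self : Separates pred R R L := by
  rintro d - h
  induction h with
  | start h1 h2 => exact h2 h1
  | step _ _ _ ih => exact ih

/-- If `B` separates `R` from `L` and `A` separates `B` from `L`, then `A` separates `R`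
from `L`. -/
theorem Separates.trans {B : Finset D} (hB : Separates pred B R L) (hA : Separates pred A B L) :
    Separates pred A R L := by
  have key : ∀ d, Reach pred R A d → Reach pred R B d ∨ Reach pred B A d := by
    intro d h
    induction h with
    | @start d h1 h2 =>
      by_cases hd : d ∈ B
      · exact .inr (.start hd h2)
      · exact .inl (.start h1 hd)
    | @step d e _ h2 h3 ih =>
      rcases ih with ih | ih
      · by_cases he : e ∈ B
        · exact .inr (.start he h3)
        · exact .inl (.step ih h2 he)
      · exact .inr (.step ih h2 h3)
  intro d hd h
  rcases key d h with h | h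
  · exact hB d hd h
  · exact hA d hd h

end Reachability

/-! ### Generic coefficients over an infinite field -/

section Kernel

variable {D K : Type*} [DecidableEq D] [Field K]

/-- `f` assigns to each vertex of the digraph with in-neighbourhoods `pred` the global kernel
determined by the local coefficients `k`. -/
def IsKernel (pred : D → Finset D) (k : D → D → K) (f : D → D → K) : Prop :=
  ∀ e, f e = ∑ d ∈ pred e, k d e • f d + Pi.single e 1

/-- The restriction of a vector to the coordinates in `R`. -/
def restrictTo (K : Type*) [Field K] (R : Finset D) : (D → K) →ₗ[K] (R → K) :=
  LinearMap.funLeft K K ((↑) : R → D)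

variable {pred : D → Finset D} {lvl : D → ℕ}

theorem exists_isKernel (hl : ∀ e, ∀ d ∈ pred e, lvl d < lvl e) (k : D → D → K) :
    ∃ f, IsKernel pred k f := by
  let F : (e : D) → ((d : D) → lvl d < lvl e → (D → K)) → (D → K) := fun e rec =>
    ∑ d ∈ (pred e).attach, k d e • rec d (hl e d d.2) + Pi.single e 1
  refine ⟨(measure lvl).wf.fix F, fun e => ?_⟩
  rw [WellFounded.fix_eq]
  simp only [F]
  rw [Finset.sum_attach (pred e) fun d => k d e • (measure lvl).wf.fix F d]

theorem finrank_span_insert_of_notMem {M : Type*} [AddCommGroup M] [Module K M]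
    [FiniteDimensional K M] {s t : Set M} {x : M} (hx : x ∉ Submodule.span K s)
    (hxt : x ∈ t) (hst : s ⊆ t) :
    Module.finrank K (Submodule.span K s) + 1 ≤ Module.finrank K (Submodule.span K t) :=
  Submodule.finrank_lt_finrank_of_lt <|
    (Submodule.span_mono hst).lt_of_not_ge fun h => hx (h (Submodule.subset_span hxt))

/-- Over an infinite field one can combine the kernels entering a vertex such that the result
avoids every span of earlier restricted kernels which does not contain all the entering ones. -/
theorem exists_generic_coefficients [Fintype D] [Infinite K] (P : Finset D) (f : D → D → K) :
    ∃ κ : D → K, ∀ R L : Finset D,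
      restrictTo K R (∑ d ∈ P, κ d • f d) ∈
        Submodule.span K ((fun d => restrictTo K R (f d)) '' L) →
      ∀ d ∈ P, restrictTo K R (f d) ∈
        Submodule.span K ((fun d => restrictTo K R (f d)) '' L) := by
  classical
  let Φ : (D → K) →ₗ[K] (D → K) := ∑ d ∈ P, (LinearMap.proj d).smulRight (f d)
  have hΦ : ∀ κ, Φ κ = ∑ d ∈ P, κ d • f d := fun κ => by simp [Φ]
  let W : Finset D × Finset D → Submodule K (D → K) := fun p =>
    (Submodule.span K ((fun d => restrictTo K p.1 (f d)) '' p.2)).comap (restrictTo K p.1 ∘ₗ Φ)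
  -- Finitely many proper subspaces do not cover the space over an infinite field. A `κ` outside all
  -- of them can lie in `W (R, L)` only if that is everything, and then unit vectors may be tested.
  let s : Finset (Submodule K (D → K)) := (Finset.univ.image W).erase ⊤
  have hs := Subspace.biUnion_ne_univ_of_top_notMem (k := K) (s := s) (Finset.notMem_erase _ _)
  obtain ⟨κ, hκ⟩ := (Set.ne_univ_iff_exists_notMem _).1 hs
  refine ⟨κ, fun R L hRL d hd => ?_⟩
  have hmem : κ ∈ W (R, L) := by simpa [W, hΦ] using hRL
  have htop : W (R, L) = ⊤ := by
    by_contra hne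
    refine hκ (Set.mem_biUnion (x := W (R, L)) ?_ hmem)
    exact Finset.mem_coe.2 (Finset.mem_erase.2 ⟨hne, Finset.mem_image_of_mem _ (Finset.mem_univ _)⟩)
  have hd' : (Pi.single d 1 : D → K) ∈ W (R, L) := htop ▸ Submodule.mem_top
  have : Φ (Pi.single d 1) = f d := by
    rw [hΦ, Finset.sum_eq_single d]
    · simp
    · intro b _ hb
      simp [Pi.single_eq_of_ne hb]
    · exact fun h => (h hd).elim
  simpa [W, this] using hd'

/-- Over an infinite field there is a choice of coefficients for which the rank of every
submatrix of the transfer matrix is at least the size of some separating set. -/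
theorem exists_generic_kernel [Fintype D] [Infinite K]
    (hl : ∀ e, ∀ d ∈ pred e, lvl d < lvl e) :
    ∃ k f : D → D → K, IsKernel pred k f ∧ ∀ R L : Finset D, ∃ A, Separates pred A R L ∧
      A.card ≤ Module.finrank K
        (Submodule.span K ((fun d => restrictTo K R (f d)) '' (L : Set D))) := by
  suffices H : ∀ S : Finset D, (∀ e ∈ S, pred e ⊆ S) → ∃ k f : D → D → K,
      (∀ e ∈ S, f e = ∑ d ∈ pred e, k d e • f d + Pi.single e 1) ∧
      (∀ d ∈ S, ∀ e ∉ S, f d e = 0) ∧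
      ∀ R L : Finset D, L ⊆ S → ∃ A, Separates pred A R L ∧ A.card ≤ Module.finrank K
        (Submodule.span K ((fun d => restrictTo K R (f d)) '' (L : Set D))) by
    obtain ⟨k, f, h1, -, h3⟩ := H Finset.univ fun _ _ => Finset.subset_univ _
    exact ⟨k, f, fun e => h1 e (Finset.mem_univ e), fun R L => h3 R L (Finset.subset_univ L)⟩
  intro S
  induction S using Finset.strongInduction with
  | H S ih =>
  intro hS
  rcases S.eq_empty_or_nonempty with rfl | hne
  · refine ⟨0, 0, by simp, by simp, fun R L hL => ⟨∅, ?_, by simp⟩⟩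
    intro d hd
    exact absurd (hL hd) (Finset.notMem_empty d)
  -- A vertex of maximal level is no in-neighbour within `S`, so `S.erase e` is still closed under
  -- `pred` and the kernel of `e` can be chosen last.
  obtain ⟨e, heS, hmax⟩ := S.exists_max_image lvl hne
  have hpe : ∀ e' ∈ S, pred e' ⊆ S.erase e := fun e' he' d hd => by
    refine Finset.mem_erase.2 ⟨?_, hS e' he' hd⟩
    rintro rfl
    exact absurd (hl e' d hd) (not_lt.2 (hmax e' he'))
  obtain ⟨k, f, hf, hsupp, hrank⟩ := ih (S.erase e) (Finset.erase_ssubset heS)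
    fun e' he' => hpe e' (Finset.mem_of_mem_erase he')
  obtain ⟨κ, hκ⟩ := exists_generic_coefficients (pred e) f
  let k' : D → D → K := fun d x => if x = e then κ d else k d x
  let f' : D → D → K := Function.update f e (∑ d ∈ pred e, κ d • f d + Pi.single e 1)
  have hf'e : f' e = ∑ d ∈ pred e, κ d • f d + Pi.single e 1 := by simp [f']
  have hf' : ∀ d ∈ S.erase e, f' d = f d := fun d hd => by
    simp [f', Function.update_of_ne (Finset.ne_of_mem_erase hd)]
  refine ⟨k', f', ?_, ?_, ?_⟩
  · intro x hx
    have hsum : ∑ d ∈ pred x, k' d x • f' d = ∑ d ∈ pred x, k' d x • f d :=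
      Finset.sum_congr rfl fun d hd => by rw [hf' d (hpe x hx hd)]
    rw [hsum]
    by_cases hxe : x = e
    · subst hxe
      simp [hf'e, k']
    · have hx' := Finset.mem_erase.2 ⟨hxe, hx⟩
      rw [hf' x hx', hf x hx']
      simp [k', hxe]
  · intro d hd x hx
    have hx' : x ∉ S.erase e := fun h => hx (Finset.mem_of_mem_erase h)
    by_cases hde : d = e
    · subst hde
      have hxd : x ≠ d := fun h => hx (h ▸ hd)
      rw [hf'e]
      simp only [Pi.add_apply, Finset.sum_apply, Pi.smul_apply, Pi.single_eq_of_ne hxd, add_zero]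
      exact Finset.sum_eq_zero fun y hy => by rw [hsupp y (hpe d hd hy) x hx', smul_zero]
    · have hd' := Finset.mem_erase.2 ⟨hde, hd⟩
      rw [hf' d hd', hsupp d hd' x hx']
  · intro R L hL
    have himg : ∀ M ⊆ S.erase e, (fun d => restrictTo K R (f' d)) '' (M : Set D) =
        (fun d => restrictTo K R (f d)) '' (M : Set D) := fun M hM =>
      Set.image_congr fun d hd => by rw [hf' d (hM hd)]
    have hLe : L.erase e ⊆ S.erase e := Finset.erase_subset_erase e hL
    by_cases heL : e ∈ L
    swap
    · rw [Finset.erase_eq_of_notMem heL] at hLe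
      obtain ⟨A, hA, hAc⟩ := hrank R L hLe
      exact ⟨A, hA, by rwa [himg L hLe]⟩
    have hsub : (fun d => restrictTo K R (f d)) '' (L.erase e : Set D) ⊆
        (fun d => restrictTo K R (f' d)) '' (L : Set D) := by
      rw [← himg _ hLe]
      exact Set.image_mono (Finset.coe_subset.2 (Finset.erase_subset _ _))
    -- Either the new column raises the rank, which pays for adding `e` to the separator, or it
    -- depends on the other columns; then genericity puts all in-neighbours of `e` in their span,
    -- and `e` can be traded for `pred e` at no cost in rank.
    by_cases hmem : restrictTo K R (f' e) ∈
        Submodule.span K ((fun d => restrictTo K R (f d)) '' (L.erase e : Set D))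
    swap
    · obtain ⟨A, hA, hAc⟩ := hrank R (L.erase e) hLe
      refine ⟨insert e A, ?_, ?_⟩
      · intro d hd hr
        have hde : d ≠ e := fun h => hr.notMem (h ▸ Finset.mem_insert_self _ _)
        exact hA d (Finset.mem_erase.2 ⟨hde, hd⟩)
          (hr.mono (Finset.Subset.refl _) (Finset.subset_insert _ _))
      · refine (Finset.card_insert_le _ _).trans ((Nat.add_le_add_right hAc 1).trans ?_)
        exact finrank_span_insert_of_notMem hmem (Set.mem_image_of_mem _ heL) hsub
    -- Coordinate `e` vanishes on all earlier kernels but equals one on that of `e`.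
    have heR : e ∉ R := by
      intro heR
      have hle : Submodule.span K ((fun d => restrictTo K R (f d)) '' (L.erase e : Set D)) ≤
          LinearMap.ker (LinearMap.proj (⟨e, heR⟩ : R) : (R → K) →ₗ[K] K) := by
        rw [Submodule.span_le]
        rintro _ ⟨d, hd, rfl⟩
        exact hsupp d (hLe hd) e (Finset.notMem_erase _ _)
      have h0 : f' e e = 0 := hle hmem
      have h1 : f' e e = 1 := by
        rw [hf'e]
        simp only [Pi.add_apply, Finset.sum_apply, Pi.smul_apply, Pi.single_eq_same]
        rw [Finset.sum_eq_zero fun y hy => by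
          rw [hsupp y (hpe e heS hy) e (Finset.notMem_erase _ _), smul_zero], zero_add]
      exact one_ne_zero (h1.symm.trans h0)
    have hsingle : restrictTo K R (Pi.single e 1) = 0 := by
      ext x
      have : (x : D) ≠ e := fun h => heR (h ▸ x.2)
      simp [restrictTo, LinearMap.funLeft_apply, this]
    rw [hf'e, map_add, hsingle, add_zero] at hmem
    have hpred := hκ R (L.erase e) hmem
    obtain ⟨A, hA, hAc⟩ := hrank R (L.erase e ∪ pred e) (Finset.union_subset hLe (hpe e heS))
    refine ⟨A, ?_, hAc.trans (Submodule.finrank_mono ?_)⟩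
    · intro d hd hr
      by_cases hde : d = e
      · subst hde
        cases hr with
        | start h1 _ => exact heR h1
        | step h1 h2 _ => exact hA _ (Finset.mem_union_right _ h2) h1
      · exact hA d (Finset.mem_union_left _ (Finset.mem_erase.2 ⟨hde, hd⟩)) hr
    · refine le_trans ?_ (Submodule.span_mono hsub)
      rw [Submodule.span_le]
      rintro _ ⟨d, hd, rfl⟩
      rcases Finset.mem_union.1 (Finset.mem_coe.1 hd) with hd | hd
      · exact Submodule.subset_span (Set.mem_image_of_mem _ hd)
      · exact hpred d hd

end Kernel
end LNEC

namespace LNEC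

/-! ### The transfer matrix and Edmonds' criterion -/

section Transfer

variable {D K : Type*} [Fintype D] [DecidableEq D] [Field K]

/-- The matrix of the local coefficients `k` on the digraph with in-neighbourhoods `pred`. -/
def localMatrix (pred : D → Finset D) (k : D → D → K) : Matrix D D K :=
  Matrix.of fun d e => if d ∈ pred e then k d e else 0

variable {pred : D → Finset D} {lvl : D → ℕ} {k f : D → D → K}

/-- Read columnwise, the kernel recursion is `G = G K + 1`. -/
theorem IsKernel.mul_eq_one (hf : IsKernel pred k f) :
    (Matrix.of fun d e => f e d) * (1 - localMatrix pred k) = 1 := by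
  rw [mul_sub, mul_one, sub_eq_iff_eq_add']
  ext d e
  have := congrFun (hf e) d
  simp only [Pi.add_apply, Finset.sum_apply, Pi.smul_apply, smul_eq_mul] at this
  simp only [Matrix.add_apply, Matrix.mul_apply, Matrix.of_apply, localMatrix, mul_ite, mul_zero,
    Finset.sum_ite_mem, Finset.univ_inter, this, Matrix.one_apply, Pi.single_apply]
  simp only [mul_comm]

theorem IsKernel.mul_eq_one' (hf : IsKernel pred k f) :
    (1 - localMatrix pred k) * (Matrix.of fun d e => f e d) = 1 :=
  mul_eq_one_comm.1 hf.mul_eq_one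

/-- The effect of a unit signal at `d`, expressed by the effects of its out-neighbours. -/
theorem IsKernel.apply_eq (hf : IsKernel pred k f) (d x : D) :
    f x d = (if d = x then 1 else 0) + ∑ e, if d ∈ pred e then k d e * f x e else 0 := by
  have h := hf.mul_eq_one'
  rw [sub_mul, one_mul, sub_eq_iff_eq_add] at h
  have := congrFun (congrFun h d) x
  simpa [Matrix.mul_apply, localMatrix, Matrix.one_apply] using this

/-- The rows of the transfer matrix at `R` are spanned by the rows at any set separating `R` from
the columns. -/
theorem IsKernel.row_mem_span {ι : Type*} {φ : ι → D} {A R L : Finset D}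
    (hl : ∀ e, ∀ d ∈ pred e, lvl d < lvl e) (hf : IsKernel pred k f)
    (hA : Separates pred A R L) (hφ : ∀ j, φ j ∈ L) {d : D} (hd : d ∈ R) :
    (fun j => f (φ j) d) ∈ Submodule.span K ((fun a j => f (φ j) a) '' (A : Set D)) := by
  obtain ⟨b, hb⟩ : ∃ b, ∀ d, lvl d ≤ b :=
    ⟨Finset.univ.sup lvl, fun d => Finset.le_sup (f := lvl) (Finset.mem_univ d)⟩
  -- Induction downwards in the level: a vertex reached while avoiding `A` is not a column, so its
  -- row is a combination of the rows of its out-neighbours, each in `A` or again reached.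
  have key : ∀ n, ∀ d, b - lvl d = n → (d ∈ A ∨ Reach pred R A d) →
      (fun j => f (φ j) d) ∈ Submodule.span K ((fun a j => f (φ j) a) '' (A : Set D)) := by
    intro n
    induction n using Nat.strong_induction_on with
    | _ n ih =>
    intro d hdn hd
    by_cases hdA : d ∈ A
    · exact Submodule.subset_span (Set.mem_image_of_mem _ hdA)
    replace hd := hd.resolve_left hdA
    have hrow : (fun j => f (φ j) d) =
        ∑ e, if d ∈ pred e then k d e • (fun j => f (φ j) e) else 0 := by
      ext j
      have hne : d ≠ φ j := fun h => hA _ (hφ j) (h ▸ hd)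
      rw [hf.apply_eq d (φ j), if_neg hne, zero_add, Finset.sum_apply]
      refine Finset.sum_congr rfl fun e _ => ?_
      split_ifs <;> simp
    rw [hrow]
    refine Submodule.sum_mem _ fun e _ => ?_
    split_ifs with he
    · refine Submodule.smul_mem _ _ (ih (b - lvl e) ?_ e rfl ?_)
      · have := hl e d he
        have := hb e
        omega
      · by_cases heA : e ∈ A
        · exact .inl heA
        · exact .inr (.step hd he heA)
    · exact Submodule.zero_mem _
  refine key _ d rfl ?_
  by_cases hdA : d ∈ A
  · exact .inl hdA
  · exact .inr (.start hd hdA)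

/-- The family of vectors whose linear independence expresses that of the rows `R` of the
transfer matrix in the columns `L`, and in which every local coefficient occurs once. -/
def edmondsFamily (pred : D → Finset D) (R L : Finset D) (k : D → D → K) :
    R ⊕ {d // d ∉ L} → (D → K) :=
  Sum.elim (fun d => Pi.single (d : D) 1) (fun d => (1 - localMatrix pred k) d)

/-- Independence in the columns `L` means independence after adjoining the unit vectors outside `L`.
Multiplying by the invertible `1 - K` turns rows of `G` into unit vectors and those unit vectors
into rows of `1 - K`. -/
theorem IsKernel.linearIndependent_iff (hf : IsKernel pred k f) (R L : Finset D) :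
    LinearIndependent K (fun (d : R) (j : L) => f j d) ↔
      LinearIndependent K (edmondsFamily pred R L k) := by
  let G : Matrix D D K := Matrix.of fun d e => f e d
  let u : R ⊕ {d // d ∉ L} → (D → K) := Sum.elim (fun d e => f e d) (fun d => Pi.single (d : D) 1)
  have hG : G * (1 - localMatrix pred k) = 1 := hf.mul_eq_one
  have hu : (1 - localMatrix pred k).vecMulLinear ∘ u = edmondsFamily pred R L k := by
    funext i
    rcases i with d | d
    · have : (fun e => f e d) = Matrix.vecMul (Pi.single (d : D) 1) G := by
        rw [Matrix.single_one_vecMul]; rfl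
      simp only [u, edmondsFamily, Function.comp_apply, Sum.elim_inl, Matrix.vecMulLinear_apply]
      rw [this, Matrix.vecMul_vecMul, hG, Matrix.vecMul_one]
    · simp only [u, edmondsFamily, Function.comp_apply, Sum.elim_inr, Matrix.vecMulLinear_apply]
      rw [Matrix.single_one_vecMul]; rfl
  have hker : LinearMap.ker (1 - localMatrix pred k).vecMulLinear = ⊥ := by
    rw [LinearMap.ker_eq_bot']
    intro y hy
    have := congrArg (fun z => Matrix.vecMul z G) hy
    rw [Matrix.vecMulLinear_apply] at this
    rwa [Matrix.vecMul_vecMul, hf.mul_eq_one', Matrix.vecMul_one, Matrix.zero_vecMul] at this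
  rw [← hu, LinearMap.linearIndependent_iff _ hker, Fintype.linearIndependent_iff,
    Fintype.linearIndependent_iff]
  constructor
  · intro h g hg
    rw [Fintype.sum_sum_type] at hg
    have hR : ∀ d : R, g (.inl d) = 0 := by
      refine h (fun d => g (.inl d)) ?_
      ext j
      have := congrFun hg j
      simp only [u, Sum.elim_inl, Sum.elim_inr, Pi.add_apply, Finset.sum_apply, Pi.smul_apply,
        smul_eq_mul, Pi.zero_apply] at this
      rw [Finset.sum_eq_zero (s := (Finset.univ : Finset {d // d ∉ L}))] at this
      · simpa using this
      · intro d _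
        have : (j : D) ≠ d := fun h => d.2 (h ▸ j.2)
        simp [this]
    rintro (d | d)
    · exact hR d
    · have := congrFun hg d
      simp only [hR, zero_smul, Finset.sum_const_zero, zero_add, u, Sum.elim_inr,
        Finset.sum_apply, Pi.smul_apply, smul_eq_mul, Pi.zero_apply] at this
      rw [Finset.sum_eq_single d] at this
      · simpa using this
      · intro b _ hb
        have : (d : D) ≠ b := fun h => hb (Subtype.ext h.symm)
        simp [this]
      · simp
  · intro h x hx d
    refine h (Sum.elim x fun d => - ∑ d' : R, x d' * f d d') ?_ (.inl d)
    rw [Fintype.sum_sum_type]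
    ext e
    simp only [u, Sum.elim_inl, Sum.elim_inr, Pi.add_apply, Finset.sum_apply, Pi.smul_apply,
      smul_eq_mul, Pi.zero_apply]
    by_cases he : e ∈ L
    · rw [Finset.sum_eq_zero (s := (Finset.univ : Finset {d // d ∉ L})), add_zero]
      · simpa using congrFun hx ⟨e, he⟩
      · intro d _
        have : e ≠ d := fun h => d.2 (h ▸ he)
        simp [this]
    · rw [Finset.sum_eq_single (⟨e, he⟩ : {d // d ∉ L})]
      · simp
      · intro b _ hb
        have : e ≠ b := fun h => hb (Subtype.ext h.symm)
        simp [this]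
      · simp

end Transfer

/-- If the columns `L` of the transfer matrix, restricted to the rows `R`, have rank `|R|`, then
these rows are linearly independent. -/
theorem linearIndependent_rows_of_card_le {D K : Type*} [Field K] {f : D → D → K}
    {R L : Finset D}
    (h : R.card ≤ Module.finrank K
      (Submodule.span K ((fun d => restrictTo K R (f d)) '' (L : Set D)))) :
    LinearIndependent K (fun (d : R) (j : L) => f j d) := by
  let B : Matrix R L K := Matrix.of fun d j => f j d
  have hcol : Set.range B.col = (fun d => restrictTo K R (f d)) '' (L : Set D) := by
    ext y
    constructor
    · rintro ⟨j, rfl⟩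
      exact ⟨j, j.2, rfl⟩
    · rintro ⟨j, hj, rfl⟩
      exact ⟨⟨j, hj⟩, rfl⟩
  rw [linearIndependent_iff_card_le_finrank_span, Fintype.card_coe]
  rw [← hcol, ← Matrix.rank_eq_finrank_span_cols, Matrix.rank_eq_finrank_span_row] at h
  exact h

end LNEC

namespace LNEC

/-! ### Moving a generic solution into a small field -/

section Hybrid

/-- If each of fewer than `|s|` conditions excludes at most one value of each variable, then a
common solution can be changed into one with all its entries in `s`. -/
theorem exists_forall_mem_of_subsingleton {ι K C : Type*} [Fintype ι] [DecidableEq ι]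
    (P : C → (ι → K) → Prop) (T : Finset C) (s : Set K) (hs : (T.card : ℕ∞) < s.encard)
    (h : ∀ c ∈ T, ∀ κ, P c κ → ∀ v, {x | ¬ P c (Function.update κ v x)}.Subsingleton)
    (κ₀ : ι → K) (hκ₀ : ∀ c ∈ T, P c κ₀) :
    ∃ κ : ι → K, (∀ v, κ v ∈ s) ∧ ∀ c ∈ T, P c κ := by
  suffices H : ∀ S : Finset ι, ∃ κ : ι → K, (∀ v ∈ S, κ v ∈ s) ∧ ∀ c ∈ T, P c κ by
    obtain ⟨κ, h1, h2⟩ := H Finset.univ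
    exact ⟨κ, fun v => h1 v (Finset.mem_univ v), h2⟩
  intro S
  induction S using Finset.induction_on with
  | empty => exact ⟨κ₀, by simp, hκ₀⟩
  | insert v S hv ih =>
    obtain ⟨κ, h1, h2⟩ := ih
    obtain ⟨x, hx, hxT⟩ : ∃ x ∈ s, ∀ c ∈ T, P c (Function.update κ v x) := by
      by_contra! hcon
      obtain ⟨x₀, hx₀⟩ : s.Nonempty := Set.encard_pos.1 (bot_le.trans_lt hs)
      obtain ⟨c₀, -⟩ := hcon x₀ hx₀
      have : Nonempty C := ⟨c₀⟩
      -- If every value in `s` violates a condition, choosing one for each value gives an injection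
      -- of `s` into `T`.
      choose! g hgT hg using hcon
      refine absurd (Set.encard_le_encard_of_injOn (s := s) (t := (T : Set C)) (f := g)
        hgT ?_) (not_le.2 (by simpa using hs))
      intro x hx y hy hxy
      exact h (g x) (hgT x hx) κ (h2 _ (hgT x hx)) v (hg x hx) (by simpa [hxy] using hg y hy)
    refine ⟨Function.update κ v x, ?_, hxT⟩
    intro w hw
    by_cases hwv : w = v
    · subst hwv
      simpa using hx
    · rw [Function.update_of_ne hwv]
      exact h1 w ((Finset.mem_insert.1 hw).resolve_left hwv)

/-- A family of vectors one of which moves on a line is linearly independent for no parameter, or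
for all but at most one. -/
theorem subsingleton_not_linearIndependent {J K M : Type*} [Field K] [AddCommGroup M] [Module K M]
    (v : K → J → M) (j₀ : J) (p w : M) (hj₀ : ∀ x, v x j₀ = p + x • w)
    (hv : ∀ x y j, j ≠ j₀ → v x j = v y j) {x₀ : K} (h : LinearIndependent K (v x₀)) :
    {x | ¬ LinearIndependent K (v x)}.Subsingleton := by
  have hiff : ∀ x, LinearIndependent K (v x) ↔
      LinearIndepOn K (v x₀) {j₀}ᶜ ∧ p + x • w ∉ Submodule.span K (v x₀ '' {j₀}ᶜ) := by
    intro x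
    have hu : (Set.univ : Set J) = insert j₀ {j₀}ᶜ := by
      ext j; simp [em]
    have hE : Set.EqOn (v x) (v x₀) {j₀}ᶜ := fun j hj => hv x x₀ j hj
    rw [← linearIndepOn_univ_iff, hu, linearIndepOn_insert (by simp), hj₀,
      linearIndepOn_congr hE, Set.image_congr hE]
  obtain ⟨hli, hmem⟩ := (hiff x₀).1 h
  intro x hx y hy
  have hx' : p + x • w ∈ Submodule.span K (v x₀ '' {j₀}ᶜ) := by
    by_contra hc; exact hx ((hiff x).2 ⟨hli, hc⟩)
  have hy' : p + y • w ∈ Submodule.span K (v x₀ '' {j₀}ᶜ) := by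
    by_contra hc; exact hy ((hiff y).2 ⟨hli, hc⟩)
  by_contra hxy
  -- Two bad parameters put the direction of the line in the span, hence the whole line, including
  -- the good point at `x₀`.
  have hw : w ∈ Submodule.span K (v x₀ '' {j₀}ᶜ) := by
    have := Submodule.sub_mem _ hx' hy'
    rw [add_sub_add_left_eq_sub, ← sub_smul] at this
    exact (Submodule.smul_mem_iff _ (sub_ne_zero.2 hxy)).1 this
  refine hmem ?_
  have := Submodule.add_mem _ hx' (Submodule.smul_mem _ (x₀ - x) hw)
  rwa [add_assoc, ← add_smul, add_sub_cancel] at this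

variable {D : Type*} [DecidableEq D] {pred : D → Finset D} {lvl : D → ℕ}

/-- The coefficient at `(a, b)` affects only row `a` of `1 - K`, moving it along a multiple of the
unit vector at `b`; if `a ∈ L`, that row is not in the family. -/
theorem subsingleton_not_linearIndependent_edmondsFamily {K : Type*} [Field K] (R L : Finset D)
    (κ : D × D → K)
    (h : LinearIndependent K (edmondsFamily pred R L fun d e => κ (d, e))) (v : D × D) :
    {x | ¬ LinearIndependent K
      (edmondsFamily pred R L fun d e => Function.update κ v x (d, e))}.Subsingleton := by
  obtain ⟨a, b⟩ := v
  have hrow : ∀ x y : K, ∀ d, d ≠ a →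
      (1 - localMatrix pred fun d e => Function.update κ (a, b) x (d, e)) d =
        (1 - localMatrix pred fun d e => Function.update κ (a, b) y (d, e)) d := by
    intro x y d hd
    ext e
    simp [localMatrix, Function.update_apply, hd]
  have h' : LinearIndependent K
      (edmondsFamily pred R L fun d e => Function.update κ (a, b) (κ (a, b)) (d, e)) := by
    simpa using h
  by_cases ha : a ∈ L
  · have hconst : ∀ x, edmondsFamily pred R L (fun d e => Function.update κ (a, b) x (d, e)) =
        edmondsFamily pred R L
          fun d e => Function.update κ (a, b) (κ (a, b)) (d, e) := by
      intro x
      funext i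
      rcases i with d | d
      · rfl
      · exact hrow _ _ d fun h => d.2 (h ▸ ha)
    intro x hx
    exact (hx (by rw [hconst x]; exact h')).elim
  · refine subsingleton_not_linearIndependent
      (v := fun x => edmondsFamily pred R L fun d e => Function.update κ (a, b) x (d, e))
      (.inr ⟨a, ha⟩)
      ((1 - localMatrix pred fun d e => Function.update κ (a, b) 0 (d, e)) a)
      (if a ∈ pred b then - Pi.single b 1 else 0) ?_ ?_ h'
    · intro x
      ext e
      simp only [edmondsFamily, Sum.elim_inr, localMatrix, Matrix.sub_apply, Matrix.of_apply,
        Function.update_apply, Prod.mk.injEq, true_and, Pi.add_apply, Pi.smul_apply, smul_eq_mul]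
      by_cases he : e = b
      · subst he
        split_ifs <;> simp_all [sub_eq_add_neg]
      · split_ifs <;> simp [he]
    · rintro x y (d | d) hd
      · rfl
      · exact hrow x y d fun h => hd (congrArg _ (Subtype.ext h))

variable [Fintype D]

/-- Fewer than `|F|` sets of rows of the transfer matrix can be made linearly independent, each in
its set of columns, provided that none of them can be separated from its columns by a smaller
set. The generic solution is taken from an infinite extension `K` of `F`. -/
theorem exists_linearIndependent_rows_of_extension {F : Type*} (K : Type*) [Field F] [Field K]
    [Algebra F K] [Infinite K]
    (hl : ∀ e, ∀ d ∈ pred e, lvl d < lvl e) (C : Finset (Finset D × Finset D))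
    (hC : (C.card : ℕ∞) < ENat.card F)
    (hsep : ∀ c ∈ C, ∀ A, Separates pred A c.1 c.2 → c.1.card ≤ A.card) :
    ∃ k f : D → D → F, IsKernel pred k f ∧
      ∀ c ∈ C, LinearIndependent F (fun (d : c.1) (j : c.2) => f j d) := by
  obtain ⟨k₀, f₀, hkf, hrank⟩ := exists_generic_kernel (K := K) hl
  let P : Finset D × Finset D → (D × D → K) → Prop := fun c κ =>
    LinearIndependent K (edmondsFamily pred c.1 c.2 fun d e => κ (d, e))
  have h0 : ∀ c ∈ C, P c fun v => k₀ v.1 v.2 := by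
    intro c hc
    refine (hkf.linearIndependent_iff c.1 c.2).1 ?_
    obtain ⟨A, hA, hAc⟩ := hrank c.1 c.2
    exact linearIndependent_rows_of_card_le ((hsep c hc A hA).trans hAc)
  have hP : ∀ c ∈ C, ∀ κ, P c κ → ∀ v, {x | ¬ P c (Function.update κ v x)}.Subsingleton :=
    fun c _ κ h v => subsingleton_not_linearIndependent_edmondsFamily c.1 c.2 κ h v
  have hinj : Function.Injective (algebraMap F K) := (algebraMap F K).injective
  have hcard : (C.card : ℕ∞) < (Set.range (algebraMap F K)).encard := by
    rwa [← Set.image_univ, hinj.encard_image, Set.encard_univ]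
  obtain ⟨κ, hκ, hκC⟩ := exists_forall_mem_of_subsingleton P C _ hcard hP
    (fun v => k₀ v.1 v.2) h0
  choose k hk using hκ
  obtain ⟨f, hf⟩ := exists_isKernel hl fun d e => k (d, e)
  refine ⟨fun d e => k (d, e), f, hf, fun c hc => ?_⟩
  rw [hf.linearIndependent_iff]
  have h1 : LinearIndependent K (edmondsFamily pred c.1 c.2 fun d e => κ (d, e)) := hκC c hc
  let ψ : (D → F) →ₗ[F] (D → K) := (Algebra.linearMap F K).compLeft D
  have hψ : (edmondsFamily pred c.1 c.2 fun d e => κ (d, e)) =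
      ψ ∘ edmondsFamily pred c.1 c.2 fun d e => k (d, e) := by
    funext i
    rcases i with d | d
    · ext e
      simp [ψ, edmondsFamily, Pi.single_apply, apply_ite (algebraMap F K)]
    · ext e
      simp [ψ, edmondsFamily, localMatrix, Matrix.one_apply, apply_ite (algebraMap F K), hk]
  rw [hψ] at h1
  refine LinearIndependent.of_comp ψ (h1.restrict_scalars ?_)
  intro x y hxy
  exact hinj (by simpa [Algebra.smul_def] using hxy)

theorem exists_linearIndependent_rows {F : Type*} [Field F]
    (hl : ∀ e, ∀ d ∈ pred e, lvl d < lvl e) (C : Finset (Finset D × Finset D))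
    (hC : (C.card : ℕ∞) < ENat.card F)
    (hsep : ∀ c ∈ C, ∀ A, Separates pred A c.1 c.2 → c.1.card ≤ A.card) :
    ∃ k f : D → D → F, IsKernel pred k f ∧
      ∀ c ∈ C, LinearIndependent F (fun (d : c.1) (j : c.2) => f j d) :=
  exists_linearIndependent_rows_of_extension (AlgebraicClosure F) hl C hC hsep

end Hybrid
end LNEC

namespace LNEC

/-! ### Network cuts and line graph separators -/

namespace Network

variable {V E : Type*} (N : Network V E)

/-- A topological ordering of the nodes. -/
theorem exists_level [Finite V] : ∃ lvl : V → ℕ, ∀ e, lvl (N.tail e) < lvl (N.head e) := by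
  have := Fintype.ofFinite V
  classical
  let r : V → V → Prop := fun a b => ∃ e : E, N.tail e = a ∧ N.head e = b
  refine ⟨fun v => (Finset.univ.filter fun u => Relation.TransGen r u v).card, fun e => ?_⟩
  have he : Relation.TransGen r (N.tail e) (N.head e) := .single ⟨e, rfl, rfl⟩
  refine Finset.card_lt_card (Finset.ssubset_iff_of_subset ?_ |>.2 ⟨N.tail e, ?_, ?_⟩)
  · intro u hu
    exact Finset.mem_filter.2 ⟨Finset.mem_univ u, (Finset.mem_filter.1 hu).2.trans he⟩
  · exact Finset.mem_filter.2 ⟨Finset.mem_univ _, he⟩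
  · exact fun h => N.acyclic _ (Finset.mem_filter.1 h).2

theorem minCut_le {T : Finset V} {A : Finset E} (h : N.IsCut T A) : N.minCut T ≤ A.card :=
  Nat.sInf_le ⟨A, h, rfl⟩

theorem isCut_univ [Fintype E] {T : Finset V} (hT : ∀ t ∈ T, t ≠ N.source) :
    N.IsCut T Finset.univ := by
  intro t ht h
  rcases Relation.ReflTransGen.cases_tail h with h | ⟨_, -, e, he, -⟩
  · exact hT t ht h
  · exact he (Finset.mem_univ e)

/-- Excluding the source guarantees that a cut exists, so `minCut` is not the default value of `sInf
∅`. -/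
theorem exists_isCut_card_eq [Fintype E] {T : Finset V} (hT : ∀ t ∈ T, t ≠ N.source) :
    ∃ A, N.IsCut T A ∧ A.card = N.minCut T :=
  Nat.sInf_mem (s := {n | ∃ A, N.IsCut T A ∧ A.card = n}) ⟨_, _, N.isCut_univ hT, rfl⟩

theorem minCut_mono [Fintype E] {T T' : Finset V} (hT' : ∀ t ∈ T', t ≠ N.source) (h : T ⊆ T') :
    N.minCut T ≤ N.minCut T' := by
  obtain ⟨A, hA, hAc⟩ := N.exists_isCut_card_eq hT'
  exact hAc ▸ N.minCut_le fun t ht => hA t (h ht)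

variable [Fintype E] [DecidableEq V] (ω : ℕ)

/-- The channels entering `T`, as vertices of the line graph. -/
def inSet (T : Finset V) : Finset (Fin ω ⊕ E) :=
  (∅ : Finset (Fin ω)).disjSum (Finset.univ.filter fun e => N.head e ∈ T)

theorem inr_mem_inSet {N : Network V E} {ω : ℕ} {T : Finset V} {e : E} :
    Sum.inr e ∈ N.inSet ω T ↔ N.head e ∈ T := by
  simp [inSet]

variable [DecidableEq E]

/-- The in-neighbourhoods in the line graph of the network, whose vertices are the message channels
and the channels. -/
def linePred : Fin ω ⊕ E → Finset (Fin ω ⊕ E) :=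
  Sum.elim (fun _ => ∅) fun e => N.incoming ω (N.tail e)

variable {ω} {N}

theorem inl_mem_incoming_iff {i : Fin ω} {v : V} :
    Sum.inl i ∈ N.incoming ω v ↔ v = N.source := by
  unfold incoming
  split_ifs with h <;> simp [h]

theorem inr_mem_incoming_iff {e : E} {v : V} : Sum.inr e ∈ N.incoming ω v ↔ N.head e = v := by
  unfold incoming
  split_ifs with h
  · simpa [h] using N.head_ne_source e
  · simp

variable (N ω) in
theorem exists_line_level [Finite V] :
    ∃ lvl : Fin ω ⊕ E → ℕ, ∀ e, ∀ d ∈ N.linePred ω e, lvl d < lvl e := by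
  obtain ⟨lvl, h⟩ := N.exists_level
  refine ⟨Sum.elim (fun _ => 0) fun e => lvl (N.tail e) + 1, ?_⟩
  rintro (i | e) (j | d) hd
  · simp [linePred] at hd
  · simp [linePred] at hd
  · simp
  · have hd' : N.head d = N.tail e := inr_mem_incoming_iff.1 hd
    simpa [hd'] using h d

/-- A set of vertices of the line graph which separates a message channel outside it from the
channels entering `T` contains a cut of the network. -/
theorem isCut_of_separates {T : Finset V} (hT : ∀ t ∈ T, t ≠ N.source)
    {A R : Finset (Fin ω ⊕ E)} (h : Separates (N.linePred ω) A R (N.inSet ω T))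
    {i : Fin ω} (hiR : Sum.inl i ∈ R) (hiA : Sum.inl i ∉ A) : N.IsCut T A.toRight := by
  intro t ht hpath
  have key : ∀ v, Relation.ReflTransGen
      (fun a b => ∃ e : E, e ∉ A.toRight ∧ N.tail e = a ∧ N.head e = b) N.source v →
      ∃ d ∈ N.incoming ω v, Reach (N.linePred ω) R A d := by
    intro v hv
    induction hv with
    | refl => exact ⟨.inl i, inl_mem_incoming_iff.2 rfl, .start hiR hiA⟩
    | tail _ he ih =>
      obtain ⟨e, heA, rfl, rfl⟩ := he
      obtain ⟨d, hd, hr⟩ := ih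
      exact ⟨.inr e, inr_mem_incoming_iff.2 rfl, hr.step hd fun h => heA (Finset.mem_toRight.2 h)⟩
  obtain ⟨d | e, hd, hr⟩ := key t hpath
  · exact hT t ht (inl_mem_incoming_iff.1 hd)
  · exact h _ (inr_mem_inSet.2 (inr_mem_incoming_iff.1 hd ▸ ht)) hr

/-- A line graph path from a message channel to `e` avoiding `A` projects to a network path from the
source to the head of `e`. -/
theorem IsCut.separates {T : Finset V} {A : Finset E} (h : N.IsCut T A) :
    Separates (N.linePred ω) ((∅ : Finset (Fin ω)).disjSum A)
      (Finset.univ.disjSum (∅ : Finset E)) (N.inSet ω T) := by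
  have key : ∀ d, Reach (N.linePred ω) (Finset.univ.disjSum (∅ : Finset E))
      ((∅ : Finset (Fin ω)).disjSum A) d → ∀ e, d = Sum.inr e → Relation.ReflTransGen
        (fun a b => ∃ e : E, e ∉ A ∧ N.tail e = a ∧ N.head e = b) N.source (N.head e) := by
    intro d hd
    induction hd with
    | start h1 _ =>
      rintro e rfl
      simp at h1
    | @step d _ h1 h2 h3 ih =>
      rintro e rfl
      have heA : e ∉ A := fun h => h3 (Finset.inr_mem_disjSum.2 h)
      rcases d with i | d
      · have hs : N.tail e = N.source := inl_mem_incoming_iff.1 h2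
        exact .single ⟨e, heA, hs, rfl⟩
      · have hs : N.head d = N.tail e := inr_mem_incoming_iff.1 h2
        exact (ih d rfl).tail ⟨e, heA, hs.symm, rfl⟩
  rintro (i | e) hd hr
  · simp [inSet] at hd
  · exact h _ (inr_mem_inSet.1 hd) (key _ hr e rfl)

variable (N ω) in
/-- A smallest set of channels separating an error pattern from the channels entering `T`. -/
theorem exists_min_separator (T : Finset V) (ρ : Finset E) : ∃ ρ' : Finset E,
    Separates (N.linePred ω) ((∅ : Finset (Fin ω)).disjSum ρ')
      ((∅ : Finset (Fin ω)).disjSum ρ) (N.inSet ω T) ∧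
    ∀ A : Finset E, Separates (N.linePred ω) ((∅ : Finset (Fin ω)).disjSum A)
      ((∅ : Finset (Fin ω)).disjSum ρ) (N.inSet ω T) → ρ'.card ≤ A.card := by
  classical
  obtain ⟨ρ', h1, h2⟩ := Finset.exists_min_image (Finset.univ.filter fun A : Finset E =>
    Separates (N.linePred ω) ((∅ : Finset (Fin ω)).disjSum A)
      ((∅ : Finset (Fin ω)).disjSum ρ) (N.inSet ω T)) Finset.card
    ⟨ρ, Finset.mem_filter.2 ⟨Finset.mem_univ ρ, separates_self⟩⟩
  exact ⟨ρ', (Finset.mem_filter.1 h1).2,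
    fun A hA => h2 A (Finset.mem_filter.2 ⟨Finset.mem_univ A, hA⟩)⟩

/-- The message channels together with a smallest separator of an error pattern of size at most
`C_T - ω` cannot be separated from `T` by fewer channels. -/
theorem card_le_of_separates {T : Finset V} (hT : ∀ t ∈ T, t ≠ N.source) {ρ ρ' : Finset E}
    (hρ : ω + ρ.card ≤ N.minCut T)
    (hsep : Separates (N.linePred ω) ((∅ : Finset (Fin ω)).disjSum ρ')
      ((∅ : Finset (Fin ω)).disjSum ρ) (N.inSet ω T))
    (hmin : ∀ A : Finset E, Separates (N.linePred ω) ((∅ : Finset (Fin ω)).disjSum A)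
      ((∅ : Finset (Fin ω)).disjSum ρ) (N.inSet ω T) → ρ'.card ≤ A.card)
    {A : Finset (Fin ω ⊕ E)}
    (hA : Separates (N.linePred ω) A (Finset.univ.disjSum ρ') (N.inSet ω T)) :
    (Finset.univ.disjSum ρ' : Finset (Fin ω ⊕ E)).card ≤ A.card := by
  have hAc := A.card_toLeft_add_card_toRight
  rw [Finset.card_disjSum, Finset.card_univ, Fintype.card_fin]
  -- If `A` holds all `ω` messages, its channels separate `ρ'`, hence `ρ`, and number at least
  -- `|ρ'|`. If it misses one, it contains a cut, of size at least `ω + |ρ| ≥ ω + |ρ'|`.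
  by_cases hall : ∀ i : Fin ω, Sum.inl i ∈ A
  · have hleft : A.toLeft = Finset.univ :=
      Finset.eq_univ_iff_forall.2 fun i => Finset.mem_toLeft.2 (hall i)
    rw [hleft, Finset.card_univ, Fintype.card_fin] at hAc
    have hright : Separates (N.linePred ω) ((∅ : Finset (Fin ω)).disjSum A.toRight)
        ((∅ : Finset (Fin ω)).disjSum ρ') (N.inSet ω T) := by
      have key : ∀ d, Reach (N.linePred ω) ((∅ : Finset (Fin ω)).disjSum ρ')
          ((∅ : Finset (Fin ω)).disjSum A.toRight) d →
          Reach (N.linePred ω) (Finset.univ.disjSum ρ') A d := by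
        intro d h
        induction h with
        | @start d h1 h2 =>
          rcases d with i | e
          · simp at h1
          · exact .start (by simpa using h1) (by simpa using h2)
        | @step d e _ h2 h3 ih =>
          rcases e with i | e
          · simp [linePred] at h2
          · exact ih.step h2 (by simpa using h3)
      exact fun d hd hr => hA d hd (key d hr)
    have := hmin _ (hsep.trans hright)
    omega
  · push Not at hall
    obtain ⟨i, hi⟩ := hall
    have h1 := N.minCut_le (isCut_of_separates hT hA (by simp) hi)
    have h2 := hmin ρ separates_self
    omega

end Network
end LNEC

namespace LNEC

/-! ### Message spaces, error spaces and minimum distance -/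

namespace Code

theorem coe_empty_disjSum {E : Type*} {ω : ℕ} (ρ : Finset E) :
    (((∅ : Finset (Fin ω)).disjSum ρ : Finset (Fin ω ⊕ E)) : Set (Fin ω ⊕ E)) =
      Sum.inr '' (ρ : Set E) := by
  ext (i | e) <;> simp

variable {V E : Type*} [Fintype E] [DecidableEq V] [DecidableEq E]
  {N : Network V E} {F : Type*} [Field F] {ω : ℕ} (c : Code N F ω)

theorem isKernel : IsKernel (N.linePred ω) (fun d => Sum.elim (fun _ => 0) (c.k d)) c.kernel := by
  rintro (i | e)
  · simpa [Network.linePred] using c.kernel_message i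
  · exact c.kernel_channel e

theorem errorSpace_eq_span (T : Finset V) (ρ : Finset E) :
    c.errorSpace T ρ = Submodule.span F (c.row T '' (Sum.inr '' (ρ : Set E))) := by
  rw [errorSpace, Set.image_image]

theorem messageSpace_eq_span (T : Finset V) :
    c.messageSpace T = Submodule.span F (c.row T '' Set.range Sum.inl) := by
  rw [messageSpace, ← Set.range_comp]; rfl

theorem errorSpace_mono {T : Finset V} {ρ ρ' : Finset E} (h : ρ ⊆ ρ') :
    c.errorSpace T ρ ≤ c.errorSpace T ρ' :=
  Submodule.span_mono (Set.image_mono (Finset.coe_subset.2 h))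

theorem finrank_errorSpace_le (T : Finset V) (ρ : Finset E) :
    Module.finrank F (c.errorSpace T ρ) ≤ ρ.card := by
  classical
  rw [errorSpace, ← Finset.coe_image]
  exact (finrank_span_finset_le_card _).trans Finset.card_image_le

variable [Fintype V]

theorem row_mem_span {T : Finset V} {A R : Finset (Fin ω ⊕ E)}
    (hA : Separates (N.linePred ω) A R (N.inSet ω T)) {d : Fin ω ⊕ E} (hd : d ∈ R) :
    c.row T d ∈ Submodule.span F (c.row T '' (A : Set (Fin ω ⊕ E))) := by
  obtain ⟨lvl, hl⟩ := N.exists_line_level ω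
  exact c.isKernel.row_mem_span (φ := fun j : {e : E // N.head e ∈ T} => Sum.inr j.1) hl hA
    (fun j => Network.inr_mem_inSet.2 j.2) hd

/-- Allows an error pattern, whose own rows may be dependent, to be replaced by a smallest
separator. -/
theorem errorSpace_le_of_separates {T : Finset V} {ρ ρ' : Finset E}
    (h : Separates (N.linePred ω) ((∅ : Finset (Fin ω)).disjSum ρ')
      ((∅ : Finset (Fin ω)).disjSum ρ) (N.inSet ω T)) :
    c.errorSpace T ρ ≤ c.errorSpace T ρ' := by
  rw [errorSpace_eq_span, errorSpace_eq_span, Submodule.span_le]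
  rintro _ ⟨_, ⟨e, he, rfl⟩, rfl⟩
  rw [← coe_empty_disjSum]
  exact c.row_mem_span h (Finset.inr_mem_disjSum.2 he)

theorem messageSpace_le_errorSpace {T : Finset V} {A : Finset E} (h : N.IsCut T A) :
    c.messageSpace T ≤ c.errorSpace T A := by
  rw [errorSpace_eq_span, messageSpace, Submodule.span_le]
  rintro _ ⟨i, rfl⟩
  rw [← coe_empty_disjSum]
  exact c.row_mem_span h.separates (by simp)

/-- The Singleton bound: the error space of `C_T - ω + 1` channels of a minimum cut meets the
message space. -/
theorem exists_errorSpace_inf_ne_bot {T : Finset V} (hT : ∀ t ∈ T, t ≠ N.source) (hω : 1 ≤ ω)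
    (hωT : ω ≤ N.minCut T) (hrank : Module.finrank F (c.messageSpace T) = ω) :
    ∃ ρ : Finset E, c.errorSpace T ρ ⊓ c.messageSpace T ≠ ⊥ ∧
      ρ.card = N.minCut T - ω + 1 := by
  obtain ⟨A, hA, hAc⟩ := N.exists_isCut_card_eq hT
  obtain ⟨ρ, hρA, hρ⟩ := Finset.exists_subset_card_eq (s := A) (n := N.minCut T - ω + 1)
    (by omega)
  refine ⟨ρ, fun hbot => ?_, hρ⟩
  have hsup : c.errorSpace T A = c.errorSpace T ρ ⊔ c.errorSpace T (A \ ρ) := by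
    rw [errorSpace, errorSpace, errorSpace, ← Submodule.span_union, ← Set.image_union,
      ← Finset.coe_union, Finset.union_sdiff_of_subset hρA]
  -- The remaining `ω - 1` channels of the cut add at most `ω - 1` dimensions to `Δ(T,ρ)`, too few
  -- for an independent `Φ(T)` of dimension `ω`.
  have h1 := Submodule.finrank_add_le_finrank_add_finrank (c.errorSpace T ρ)
    (c.errorSpace T (A \ ρ))
  have h2 := c.finrank_errorSpace_le T (A \ ρ)
  rw [Finset.card_sdiff_of_subset hρA] at h2
  have h3 := Submodule.finrank_sup_add_finrank_inf_eq (c.errorSpace T ρ) (c.messageSpace T)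
  rw [hbot, finrank_bot, hrank] at h3
  have h4 := Submodule.finrank_mono
    (sup_le (c.errorSpace_mono hρA) (c.messageSpace_le_errorSpace hA))
  rw [hsup] at h4
  omega

/-- Linear independence of the message rows together with the rows of a separator, for each error
pattern of size `C_T - ω`, makes the code attain the Singleton bound at `T`. -/
theorem finrank_and_minDist_of_linearIndepOn {T : Finset V} (hT : ∀ t ∈ T, t ≠ N.source)
    (hω : 1 ≤ ω) (hωT : ω ≤ N.minCut T)
    (h : ∀ ρ : Finset E, ρ.card = N.minCut T - ω → ∃ ρ' : Finset E,
      Separates (N.linePred ω) ((∅ : Finset (Fin ω)).disjSum ρ')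
        ((∅ : Finset (Fin ω)).disjSum ρ) (N.inSet ω T) ∧
      LinearIndepOn F (c.row T) (Finset.univ.disjSum ρ' : Finset (Fin ω ⊕ E))) :
    Module.finrank F (c.messageSpace T) = ω ∧ c.minDist T = N.minCut T - ω + 1 := by
  have hcoe : ∀ ρ : Finset E, ((Finset.univ.disjSum ρ : Finset (Fin ω ⊕ E)) : Set (Fin ω ⊕ E)) =
      Set.range Sum.inl ∪ Sum.inr '' (ρ : Set E) := fun ρ => by
    ext (i | e) <;> simp
  have hdisj : ∀ ρ : Finset E, Disjoint (Set.range Sum.inl)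
      (Sum.inr '' (ρ : Set E) : Set (Fin ω ⊕ E)) :=
    fun ρ => Set.disjoint_left.2 (by rintro _ ⟨i, rfl⟩ ⟨e, -, he⟩; cases he)
  have hcard : N.minCut T - ω ≤ Fintype.card E :=
    (Nat.sub_le _ _).trans (N.minCut_le (N.isCut_univ hT))
  have hrank : Module.finrank F (c.messageSpace T) = ω := by
    obtain ⟨ρ, -, hρ⟩ := Finset.exists_superset_card_eq (s := (∅ : Finset E)) (by simp) hcard
    obtain ⟨ρ', -, hli⟩ := h ρ hρ
    rw [hcoe, linearIndepOn_union_iff (hdisj ρ'), linearIndepOn_range_iff Sum.inl_injective] at hli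
    exact (finrank_span_eq_card hli.1).trans (Fintype.card_fin ω)
  refine ⟨hrank, le_antisymm
    (Nat.sInf_le (c.exists_errorSpace_inf_ne_bot hT hω hωT hrank))
    (le_csInf ⟨_, c.exists_errorSpace_inf_ne_bot hT hω hωT hrank⟩ ?_)⟩
  rintro _ ⟨ρ, hne, rfl⟩
  by_contra! hlt
  -- Error spaces grow with the pattern, so conditions at size exactly `C_T - ω` cover all smaller
  -- patterns.
  obtain ⟨ρ₁, hsub, hρ₁⟩ := Finset.exists_superset_card_eq (s := ρ) (Nat.lt_succ_iff.1 hlt) hcard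
  obtain ⟨ρ', hsep, hli⟩ := h ρ₁ hρ₁
  rw [hcoe, linearIndepOn_union_iff (hdisj ρ'), ← errorSpace_eq_span, ← messageSpace_eq_span] at hli
  exact hne (hli.2.2.symm.mono_left
    ((c.errorSpace_mono hsub).trans (c.errorSpace_le_of_separates hsep))).eq_bot

/-- If the cut of `T` is smaller than the rate and as many message rows are linearly independent,
then the message space is spanned by the rows of a cut and the minimum distance is one. -/
theorem finrank_and_minDist_of_minCut_lt {T : Finset V} (hT : ∀ t ∈ T, t ≠ N.source)
    (hpos : 1 ≤ N.minCut T) {M : Finset (Fin ω)} (hM : M.card = N.minCut T)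
    (h : LinearIndepOn F (c.row T) (M.disjSum ∅ : Finset (Fin ω ⊕ E))) :
    Module.finrank F (c.messageSpace T) = N.minCut T ∧ c.minDist T = 1 := by
  obtain ⟨A, hA, hAc⟩ := N.exists_isCut_card_eq hT
  have hle := c.messageSpace_le_errorSpace hA
  have h1 : N.minCut T ≤ Module.finrank F (c.messageSpace T) := by
    have h2 := (finrank_span_eq_card h).trans (Fintype.card_coe _)
    rw [Finset.card_disjSum, Finset.card_empty, add_zero, hM] at h2
    rw [← h2]
    refine Submodule.finrank_mono (Submodule.span_mono ?_)
    rintro _ ⟨⟨d, hd⟩, rfl⟩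
    rcases d with i | e
    · exact ⟨i, rfl⟩
    · simp at hd
  have h2 : Module.finrank F (c.errorSpace T A) ≤ N.minCut T :=
    (c.finrank_errorSpace_le T A).trans hAc.le
  have h3 := Submodule.finrank_mono hle
  have heq : c.messageSpace T = c.errorSpace T A :=
    Submodule.eq_of_le_of_finrank_le hle (h2.trans h1)
  obtain ⟨a, ha, hrow⟩ : ∃ a ∈ A, c.row T (Sum.inr a) ≠ 0 := by
    by_contra! hcon
    have : c.errorSpace T A = ⊥ := by
      rw [errorSpace, Submodule.span_eq_bot]
      rintro _ ⟨a, ha, rfl⟩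
      exact hcon a ha
    rw [heq, this, finrank_bot] at h1
    omega
  have hmem : 1 ∈ {n : ℕ | ∃ ρ : Finset E, c.errorSpace T ρ ⊓ c.messageSpace T ≠ ⊥ ∧
      ρ.card = n} := by
    refine ⟨{a}, ?_, Finset.card_singleton a⟩
    rw [heq, inf_eq_left.2 (c.errorSpace_mono (Finset.singleton_subset_iff.2 ha))]
    simpa [errorSpace] using hrow
  refine ⟨le_antisymm (h3.trans h2) h1, le_antisymm (Nat.sInf_le hmem) (le_csInf ⟨1, hmem⟩ ?_)⟩
  rintro _ ⟨ρ, hne, rfl⟩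
  rw [Nat.one_le_iff_ne_zero, Finset.card_ne_zero, Finset.nonempty_iff_ne_empty]
  rintro rfl
  exact hne (by simp [errorSpace])

end Code

/-! ### Counting conditions and assembling the code -/

section Existence

variable {V E : Type*} [Fintype V] [Fintype E] [DecidableEq V] [DecidableEq E]

/-- Over a sufficiently large field there is a code which attains the Singleton bound at all
collections of two given families. -/
theorem exists_code_attaining_singletonBound {α : Type*} (N : Network V E) (F : Type*) [Field F]
    {ω : ℕ} (hω : 1 ≤ ω) (T : α → Finset V) (S₁ S₂ : Finset α)
    (hT₁ : ∀ a ∈ S₁, ∀ t ∈ T a, t ≠ N.source) (hT₂ : ∀ a ∈ S₂, ∀ t ∈ T a, t ≠ N.source)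
    (hS₁ : ∀ a ∈ S₁, ω ≤ N.minCut (T a)) (hS₂ : ∀ a ∈ S₂, N.minCut (T a) < ω)
    (hpos : ∀ a ∈ S₂, 1 ≤ N.minCut (T a))
    (hF : ((∑ a ∈ S₁, (Fintype.card E).choose (N.minCut (T a) - ω) + S₂.card : ℕ) : ℕ∞) <
      ENat.card F) :
    ∃ c : Code N F ω, ∀ a, a ∈ S₁ ∨ a ∈ S₂ →
      Module.finrank F (c.messageSpace (T a)) = min ω (N.minCut (T a)) ∧
      c.minDist (T a) = Code.singletonBound N ω (T a) := by
  classical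
  obtain ⟨lvl, hl⟩ := N.exists_line_level ω
  choose sep hsep hmin using fun a => N.exists_min_separator ω (T a)
  have hM : ∀ a, ∃ M : Finset (Fin ω), N.minCut (T a) < ω → M.card = N.minCut (T a) := by
    intro a
    by_cases h : N.minCut (T a) < ω
    · obtain ⟨M, -, hM⟩ := Finset.exists_subset_card_eq (s := (Finset.univ : Finset (Fin ω)))
        (n := N.minCut (T a)) (by simpa using h.le)
      exact ⟨M, fun _ => hM⟩
    · exact ⟨∅, fun h' => (h h').elim⟩
  choose M hM using hM
  let C₁ : Finset (Finset (Fin ω ⊕ E) × Finset (Fin ω ⊕ E)) := S₁.biUnion fun a =>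
    (Finset.univ.powersetCard (N.minCut (T a) - ω)).image fun ρ : Finset E =>
      (Finset.univ.disjSum (sep a ρ), N.inSet ω (T a))
  let C₂ : Finset (Finset (Fin ω ⊕ E) × Finset (Fin ω ⊕ E)) :=
    S₂.image fun a => ((M a).disjSum ∅, N.inSet ω (T a))
  have hcard : (C₁ ∪ C₂).card ≤
      ∑ a ∈ S₁, (Fintype.card E).choose (N.minCut (T a) - ω) + S₂.card := by
    refine (Finset.card_union_le _ _).trans (Nat.add_le_add ?_ Finset.card_image_le)
    refine Finset.card_biUnion_le.trans (Finset.sum_le_sum fun a _ => ?_)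
    refine Finset.card_image_le.trans_eq ?_
    rw [Finset.card_powersetCard, Finset.card_univ]
  obtain ⟨k, f, hf, hli⟩ := exists_linearIndependent_rows (F := F) hl (C₁ ∪ C₂)
    (lt_of_le_of_lt (by exact_mod_cast hcard) hF) (by
      intro p hp A hA
      rcases Finset.mem_union.1 hp with hp | hp
      · obtain ⟨a, ha, hp⟩ := Finset.mem_biUnion.1 hp
        obtain ⟨ρ, hρ, rfl⟩ := Finset.mem_image.1 hp
        have := hS₁ a ha
        exact Network.card_le_of_separates (hT₁ a ha)
          (by rw [(Finset.mem_powersetCard.1 hρ).2]; omega) (hsep a ρ) (hmin a ρ) hA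
      · obtain ⟨a, ha, rfl⟩ := Finset.mem_image.1 hp
        have hMa := hM a (hS₂ a ha)
        -- A separator either contains all of `M a` or misses a message and so contains a cut; both
        -- bounds are `C_T`.
        by_cases hall : ∀ i ∈ M a, Sum.inl i ∈ A
        · refine Finset.card_le_card ?_
          rintro (i | e) hd
          · exact hall i (Finset.inl_mem_disjSum.1 hd)
          · simp at hd
        · push Not at hall
          obtain ⟨i, hi, hiA⟩ := hall
          have := N.minCut_le (Network.isCut_of_separates (hT₂ a ha) hA
            (Finset.inl_mem_disjSum.2 hi) hiA)
          have := A.card_toLeft_add_card_toRight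
          simp only [Finset.card_disjSum, Finset.card_empty]
          omega)
  let c : Code N F ω :=
    { k := fun d e => k d (Sum.inr e)
      kernel := f
      kernel_message := fun i => by simpa [Network.linePred] using hf (Sum.inl i)
      kernel_channel := fun e => hf (Sum.inr e) }
  have hrow : ∀ p ∈ C₁ ∪ C₂, ∀ a, p.2 = N.inSet ω (T a) →
      LinearIndepOn F (c.row (T a)) (p.1 : Set (Fin ω ⊕ E)) := by
    intro p hp a hpa
    have h := Fintype.linearIndependent_iff.1 (hli p hp)
    refine Fintype.linearIndependent_iff.2 fun g hg => h g ?_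
    ext ⟨j, hj⟩
    rw [hpa] at hj
    rcases j with i | e
    · simp [Network.inSet] at hj
    · simpa [Code.row, c] using congrFun hg ⟨e, Network.inr_mem_inSet.1 hj⟩
  refine ⟨c, fun a ha => ?_⟩
  rcases ha with ha | ha
  · rw [Code.singletonBound, if_pos (hS₁ a ha), min_eq_left (hS₁ a ha)]
    refine c.finrank_and_minDist_of_linearIndepOn (hT₁ a ha) hω (hS₁ a ha) fun ρ hρ =>
      ⟨sep a ρ, hsep a ρ, hrow (_, _) (Finset.mem_union_left _ (Finset.mem_biUnion.2 ⟨a, ha,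
        Finset.mem_image_of_mem _ (Finset.mem_powersetCard.2 ⟨Finset.subset_univ ρ, hρ⟩)⟩)) a rfl⟩
  · have hlt := hS₂ a ha
    rw [Code.singletonBound, if_neg (not_le.2 hlt), min_eq_right hlt.le]
    exact c.finrank_and_minDist_of_minCut_lt (hT₂ a ha) (hpos a ha) (hM a hlt)
      (hrow (_, _) (Finset.mem_union_right _ (Finset.mem_image_of_mem _ ha)) a rfl)

end Existence

end LNEC

theorem mainTheorem9 {V E : Type*} [Fintype V] [Fintype E] [DecidableEq V] [DecidableEq E]
    (N : LNEC.Network V E) (F : Type*) [Field F] (ω : ℕ) (hω : 1 ≤ ω) :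
    -- multicast
    (((∑ t ∈ N.nonSource with ω ≤ N.minCut {t},
          (Fintype.card E).choose (N.minCut {t} - ω) : ℕ) : ℕ∞) < ENat.card F →
        ∃ c : LNEC.Code N F ω, c.IsMulticastMDS) ∧
    -- broadcast
    ((∀ t ∈ N.nonSource, 1 ≤ N.minCut {t}) →
      ((∑ t ∈ N.nonSource with ω ≤ N.minCut {t},
            (Fintype.card E).choose (N.minCut {t} - ω) +
          (N.nonSource.filter fun t => N.minCut {t} < ω).card : ℕ) : ℕ∞) < ENat.card F →
        ∃ c : LNEC.Code N F ω, c.IsBroadcastMDS) ∧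
    -- dispersion
    ((∀ t ∈ N.nonSource, 1 ≤ N.minCut {t}) →
      ((∑ T ∈ N.collections with ω ≤ N.minCut T,
            (Fintype.card E + ∑ T' ∈ N.collections, ∑ t ∈ T', N.minCut {t}).choose
              (N.minCut T - ω) +
          (N.collections.filter fun T => N.minCut T < ω).card : ℕ) : ℕ∞) < ENat.card F →
        ∃ c : LNEC.Code N F ω, c.IsDispersionMDS) := by
  have hns : ∀ t ∈ N.nonSource, ∀ u ∈ ({t} : Finset V), u ≠ N.source := by
    intro t ht u hu
    rw [Finset.mem_singleton.1 hu]
    exact (Finset.mem_filter.1 ht).2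
  have hcol : ∀ T ∈ N.collections, ∀ t ∈ T, t ≠ N.source := fun T hT t ht =>
    (Finset.mem_filter.1 (Finset.mem_powerset.1 (Finset.mem_filter.1 hT).1 ht)).2
  refine ⟨fun hF => ?_, fun hpos hF => ?_, fun hpos hF => ?_⟩
  · obtain ⟨c, hc⟩ := LNEC.exists_code_attaining_singletonBound N F hω (fun t => {t})
      (N.nonSource.filter fun t => ω ≤ N.minCut {t}) ∅
      (fun t ht => hns t (Finset.mem_filter.1 ht).1) (by simp)
      (fun t ht => (Finset.mem_filter.1 ht).2) (by simp) (by simp) (by simpa using hF)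
    have hc' : ∀ t ∈ N.nonSource, ω ≤ N.minCut {t} →
        Module.finrank F (c.messageSpace {t}) = ω ∧ c.minDist {t} = N.minCut {t} - ω + 1 := by
      intro t ht hω'
      have := hc t (.inl (Finset.mem_filter.2 ⟨ht, hω'⟩))
      rwa [LNEC.Code.singletonBound, if_pos hω', min_eq_left hω'] at this
    exact ⟨c, fun t ht h => (hc' t ht h).1, fun t ht h => (hc' t ht h).2⟩
  · obtain ⟨c, hc⟩ := LNEC.exists_code_attaining_singletonBound N F hω (fun t => {t})
      (N.nonSource.filter fun t => ω ≤ N.minCut {t})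
      (N.nonSource.filter fun t => N.minCut {t} < ω)
      (fun t ht => hns t (Finset.mem_filter.1 ht).1)
      (fun t ht => hns t (Finset.mem_filter.1 ht).1)
      (fun t ht => (Finset.mem_filter.1 ht).2) (fun t ht => (Finset.mem_filter.1 ht).2)
      (fun t ht => hpos t (Finset.mem_filter.1 ht).1) hF
    have hc' := fun t (ht : t ∈ N.nonSource) => hc t <|
      (le_or_gt ω (N.minCut {t})).imp (fun h => Finset.mem_filter.2 ⟨ht, h⟩)
        fun h => Finset.mem_filter.2 ⟨ht, h⟩
    exact ⟨c, fun t ht => (hc' t ht).1, fun t ht => (hc' t ht).2⟩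
  · have hpos' : ∀ T ∈ N.collections, 1 ≤ N.minCut T := by
      intro T hT
      obtain ⟨hTp, t, ht⟩ := Finset.mem_filter.1 hT
      exact (hpos t (Finset.mem_powerset.1 hTp ht)).trans
        (N.minCut_mono (hcol T hT) (Finset.singleton_subset_iff.2 ht))
    obtain ⟨c, hc⟩ := LNEC.exists_code_attaining_singletonBound N F hω (fun T => T)
      (N.collections.filter fun T => ω ≤ N.minCut T)
      (N.collections.filter fun T => N.minCut T < ω)
      (fun T hT => hcol T (Finset.mem_filter.1 hT).1)
      (fun T hT => hcol T (Finset.mem_filter.1 hT).1)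
      (fun T hT => (Finset.mem_filter.1 hT).2) (fun T hT => (Finset.mem_filter.1 hT).2)
      (fun T hT => hpos' T (Finset.mem_filter.1 hT).1) (by
        -- The construction needs only `binom(|E|, δ_T)` conditions per collection; the larger upper
        -- index makes the assumed bound stronger than necessary.
        refine lt_of_le_of_lt (Nat.cast_le.2 (Nat.add_le_add_right ?_ _)) hF
        exact Finset.sum_le_sum fun T _ => Nat.choose_le_choose _ (Nat.le_add_right _ _))
    have hc' := fun T (hT : T ∈ N.collections) => hc T <|
      (le_or_gt ω (N.minCut T)).imp (fun h => Finset.mem_filter.2 ⟨hT, h⟩)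
        fun h => Finset.mem_filter.2 ⟨hT, h⟩
    exact ⟨c, fun T hT => (hc' T hT).1, fun T hT => (hc' T hT).2⟩
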